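/- **System.** Let $\Pi$ be a finite set of processes, $F\subset\Pi$ the (static) set of Byzantine processes, $C=\Pi\setminus F$ the set of correct ones, and $f\ge|F|$ a fault threshold that no process knows. Each process $i$ has a participant detector output $\mathit{PD}_i\subseteq\Pi$; the knowledge connectivity graph $G_{\mathrm{di}}$ has vertex set $\Pi$ and an edge $(i,j)$ iff $j\in\mathit{PD}_i$, and $G_{\mathrm{safe}}$ is its subgraph induced on $C$. Processes exchange messages over authenticated reliable point-to-point channels under partial synchrony (for each execution there are a time GST and a $\delta$ such that after GST message delays between correct processes are bounded by $\delta$). Byzantine processes behave arbitrarily, but cannot impersonate correct processes or forge their signatures $\langle\cdot\rangle_i$. **Graph notions.** Paths are node-disjoint if they share no node except their endpoints. In a directed graph, for non-empty node sets $A,B$, write $A\overset{>y}{\Rightarrow}B$ (resp. $A\overset{\le y}{\Rightarrow}B$) if from every $a\in A$ to every $b\in B$ the number of node-disjoint paths is greater than $y$ (resp. at most $y$). $\kappa(H)$ is the largest $k$ such that $H$ has more than $k$ nodes and any two distinct nodes of $H$ are joined, in each direction, by at least $k$ node-disjoint paths in $H$; for a node set $S$, $\kappa(S)$ is that of the induced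 subgraph. A sink component is a strongly connected component that no path leaves. A directed graph with node set $V$ belongs to *$k$-OSR PD* if its underlying undirected graph is connected, it has exactly one sink component $V_{\mathrm{sink}}$, $\kappa(V_{\mathrm{sink}})\ge k$, and there are at least $k$ node-disjoint paths from each node outside $V_{\mathrm{sink}}$ to each node of $V_{\mathrm{sink}}$. It belongs to *extended $k$-OSR PD* if moreover, for some integer $y\ge0$, exactly one set $P\subseteq V_{\mathrm{sink}}$ (a core) satisfies $\kappa(P)\ge y+1$ and $P\overset{\le y}{\Rightarrow}T$ for all non-empty $T\subseteq V\setminus P$. $G_{\mathrm{di}}$ *satisfies the requirements of the BFT-CUPFT model* if $G_{\mathrm{safe}}$ belongs to extended $(f+1)$-OSR PD with a sink component and a core that each have at least $2f+1$ elements. **Algorithms.** Discovery: process $i$ keeps sets $S_{PD}$, initially $\{\langle i,\mathit{PD}_i\rangle_i\}$, $S_{known}$, initially $\mathit{PD}_i\cup\{i\}$, and $S_{received}$, initially $\{i\}$. It repeatedly sends GetPDs to all members of $S_{known}$, answers each GetPDs with its current $S_{PD}$, and upon receiving from $j$ a set $pds_j$ of signed records that contains a record signed by $j$, it adds to $S_{PD}$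 the records in $pds_j$, to $S_{known}$ all processes listed in them, and to $S_{received}$ all their signers. Core: process $i$ runs Discovery in the background and waits until there are an integer $y\ge0$ and a set $R\subseteq S_{received}$ such that $\kappa(R)\ge y+1$ and, for every $K\subseteq(S_{known}\cup S_{received})\setminus R$, $R\overset{>y}{\Rightarrow}K$ implies $|K|\le y$; here $\kappa$ and the paths refer to the graph on $S_{known}\cup S_{received}$ whose edges are the pairs $(a,b)$ such that $S_{PD}$ contains a record signed by $a$ that lists $b$. It then returns $K\cup R$ for a $K\subseteq (S_{known}\cup S_{received})\setminus R$ with $R\overset{>y}{\Rightarrow}K$ if there is one, and $R$ otherwise. **Theorem.** If the knowledge connectivity graph satisfies the requirements of the BFT-CUPFT model, then in every execution in which all correct processes run the Core algorithm, the Core algorithm executed by any correct process eventually terminates; in particular, its waiting condition eventually holds for some $y$ and $R$. -/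

import Mathlib

namespace CUPFT

section Graphs

variable {V : Type*}

/-! ### Directed graphs

A directed graph whose vertex set is a finite set `S` of processes is given by a relation
`G : Digraph V` together with `S : Finset V`; it is the graph `G[S]` induced by `G` on `S`. -/

/-- `p` lists the successive vertices of a simple directed path of `G[S]` from `i` to `j`. -/
def IsPath (G : Digraph V) (S : Finset V) (i j : V) (p : List V) : Prop :=
  p.head? = some i ∧ p.getLast? = some j ∧ p.Nodup ∧ p.IsChain G.Adj ∧ ∀ v ∈ p, v ∈ S

/-- In `G[S]` there are (at least) `k` distinct paths from `i` to `j` that pairwise share no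
vertex other than their endpoints. -/
def HasDisjointPaths (G : Digraph V) (S : Finset V) (k : ℕ) (i j : V) : Prop :=
  ∃ p : Fin k → List V, Function.Injective p ∧ (∀ a, IsPath G S i j (p a)) ∧
    ∀ a b, a ≠ b → ∀ v, v ∈ p a → v ∈ p b → v = i ∨ v = j

/-- `A ⇒^{> y} B` in `G[S]`: both sets are non-empty, and from every member of `A` to every
member of `B` the number of node-disjoint paths is greater than `y`. -/
def ManyPaths (G : Digraph V) (S : Finset V) (y : ℕ) (A B : Finset V) : Prop :=
  A.Nonempty ∧ B.Nonempty ∧ ∀ a ∈ A, ∀ b ∈ B, HasDisjointPaths G S (y + 1) a b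

/-- `A ⇒^{≤ y} B` in `G[S]`: from every member of `A` to every member of `B` the number of
node-disjoint paths is at most `y`. -/
def FewPaths (G : Digraph V) (S : Finset V) (y : ℕ) (A B : Finset V) : Prop :=
  ∀ a ∈ A, ∀ b ∈ B, ¬ HasDisjointPaths G S (y + 1) a b

/-- `G[S]` is `k`-strongly connected: any two distinct vertices are joined, in both directions, by
at least `k` node-disjoint paths. As usual for connectivity, more than `k` vertices are required;
this follows from the condition on paths as soon as there are two vertices, and it gives a
one-vertex graph connectivity `0`. -/
def IsKStronglyConnected (G : Digraph V) (S : Finset V) (k : ℕ) : Prop :=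
  k < S.card ∧ ∀ i ∈ S, ∀ j ∈ S, i ≠ j → HasDisjointPaths G S k i j

/-- The strong connectivity `κ(G[S])`: the largest `k` such that `G[S]` is `k`-strongly connected
(the set below is bounded by the number of vertices; the empty graph gets `0`). -/
noncomputable def strongConnectivity (G : Digraph V) (S : Finset V) : ℕ :=
  sSup {k | IsKStronglyConnected G S k}

/-- `j` can be reached from `i` in `G[S]`. -/
def Reaches (G : Digraph V) (S : Finset V) (i j : V) : Prop :=
  Relation.ReflTransGen (fun a b => a ∈ S ∧ b ∈ S ∧ G.Adj a b) i j

/-- `W` is the vertex set of a strongly connected component of `G[S]`. -/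
def IsStrongComponent (G : Digraph V) (S W : Finset V) : Prop :=
  ∃ v ∈ S, ∀ w, w ∈ W ↔ w ∈ S ∧ Reaches G S v w ∧ Reaches G S w v

/-- `W` is the vertex set of a sink component of `G[S]`: a strongly connected component that no
path leaves. -/
def IsSinkComponent (G : Digraph V) (S W : Finset V) : Prop :=
  IsStrongComponent G S W ∧ ∀ w ∈ W, ∀ x ∈ S, Reaches G S w x → x ∈ W

/-- `G[S]` belongs to `k`-OSR PD, and `W` is (the vertex set of) its unique sink component. -/
structure IsOSRWithSink (G : Digraph V) (S : Finset V) (k : ℕ) (W : Finset V) : Prop where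
  connected : (G.toSimpleGraphInclusive.induce (S : Set V)).Connected
  sink : IsSinkComponent G S W
  sink_unique : ∀ W', IsSinkComponent G S W' → W' = W
  sink_connectivity : IsKStronglyConnected G W k
  paths_to_sink : ∀ i ∈ S, i ∉ W → ∀ j ∈ W, HasDisjointPaths G S k i j

/-- The two conditions on a core `P` of `G[S]`, for a given non-negative integer `y`. -/
def CoreConditions (G : Digraph V) (S : Finset V) (y : ℕ) (P : Finset V) : Prop :=
  P ⊆ S ∧ y + 1 ≤ strongConnectivity G P ∧
    ∀ T : Finset V, T ⊆ S → Disjoint T P → FewPaths G S y P T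

/-- `G[S]` belongs to extended `k`-OSR PD, with sink component `W` and core `P`: for some
non-negative integer `y`, `P` is the only subset of `W` that satisfies the core conditions. -/
structure IsExtendedOSR (G : Digraph V) (S : Finset V) (k : ℕ) (W P : Finset V) : Prop where
  osr : IsOSRWithSink G S k W
  core : ∃ y : ℕ, P ⊆ W ∧ CoreConditions G S y P ∧
    ∀ P' : Finset V, P' ⊆ W → CoreConditions G S y P' → P' = P

end Graphs

section Model

variable {Proc : Type*} [Fintype Proc] [DecidableEq Proc]

/-- The knowledge connectivity graph given by the participant detectors. -/
def knowledgeGraph (PD : Proc → Finset Proc) : Digraph Proc where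
  Adj i j := j ∈ PD i

/-- The knowledge connectivity graph of `PD`, with set `F` of faulty processes and fault threshold
`f`, satisfies the requirements of the BFT-CUPFT model. The safe subgraph is the graph induced on
the set `Fᶜ` of correct processes. -/
def SatisfiesBFTCUPFT (PD : Proc → Finset Proc) (F : Finset Proc) (f : ℕ) : Prop :=
  ∃ W P : Finset Proc, IsExtendedOSR (knowledgeGraph PD) Fᶜ (f + 1) W P ∧
    2 * f + 1 ≤ W.card ∧ 2 * f + 1 ≤ P.card

/-- A record `⟨k, D⟩_k`: a participant detector output `D` claimed and signed by process `k`. -/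
abbrev SignedPD (Proc : Type*) := Proc × Finset Proc

/-- The two kinds of messages of the Discovery algorithm. -/
inductive Msg (Proc : Type*)
  | getPDs
  | setPDs (pds : Finset (SignedPD Proc))

/-- A message together with its (authenticated) sender and its addressee. -/
structure Envelope (Proc : Type*) where
  src : Proc
  dst : Proc
  msg : Msg Proc

/-- The local state of a process: the sets `S_PD`, `S_known`, `S_received` of the Discovery
algorithm, and the value that the Core algorithm has returned (`none` while it has not
terminated). -/
structure LocalState (Proc : Type*) where
  pds : Finset (SignedPD Proc)
  known : Finset Proc
  received : Finset Proc
  result : Option (Finset Proc)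

/-- The state of process `i` when it starts the Core algorithm and forks the Discovery task. -/
def initState (PD : Proc → Finset Proc) (i : Proc) : LocalState Proc where
  pds := {(i, PD i)}
  known := insert i (PD i)
  received := {i}
  result := none

/-- The effect on the local state of receiving message `m` from process `j`: a `SetPDs` message
that contains the sender's own record is merged into the three sets, everything else leaves the
local state unchanged. -/
def handle (s : LocalState Proc) (j : Proc) : Msg Proc → LocalState Proc
  | Msg.getPDs => s
  | Msg.setPDs pds =>
      if j ∈ pds.image Prod.fst then
        { pds := s.pds ∪ pds
          known := s.known ∪ pds.biUnion Prod.snd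
          received := s.received ∪ pds.image Prod.fst
          result := s.result }
      else s

/-- The knowledge connectivity graph as seen in a local state: there is an edge `a → b` when a
record signed by `a` that lists `b` has been received. -/
def LocalState.graph (s : LocalState Proc) : Digraph Proc where
  Adj a b := ∃ D, (a, D) ∈ s.pds ∧ b ∈ D

/-- The vertices of the graph seen in a local state: `S_known ∪ S_received`. -/
def LocalState.verts (s : LocalState Proc) : Finset Proc := s.known ∪ s.received

/-- `K ⊆ (S_known ∪ S_received) \ R` and `R ⇒^{> y} K`, in the graph seen in the local state. -/
def LocalState.Extends (s : LocalState Proc) (y : ℕ) (R K : Finset Proc) : Prop :=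
  K ⊆ s.verts \ R ∧ ManyPaths s.graph s.verts y R K

/-- The condition that the Core algorithm waits for, for given `y` and `R`. -/
def LocalState.CoreGuard (s : LocalState Proc) (y : ℕ) (R : Finset Proc) : Prop :=
  R ⊆ s.received ∧ y + 1 ≤ strongConnectivity s.graph R ∧
    ∀ K : Finset Proc, K ⊆ s.verts \ R → ManyPaths s.graph s.verts y R K → K.card ≤ y

/-- One evaluation of the `wait until` of the Core algorithm, with local state `s` before and `s'`
after it. If the algorithm is still waiting and the condition holds for some `y` and `R`, then it
returns, for some such `y` and `R`, a set `K ∪ R` where `R ⇒^{> y} K` if there is such a `K`, and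
`R` otherwise; if the condition does not hold, it goes on waiting. -/
def CoreStep (s s' : LocalState Proc) : Prop :=
  (s.result = none ∧ ∃ y R res, s.CoreGuard y R ∧ s' = { s with result := some res } ∧
      ((∃ K, s.Extends y R K ∧ res = K ∪ R) ∨ ((¬ ∃ K, s.Extends y R K) ∧ res = R)))
  ∨ ((s.result ≠ none ∨ ¬ ∃ y R, s.CoreGuard y R) ∧ s' = s)

/-- The events of an execution. -/
inductive Event (Proc : Type*)
  /-- the correct process `i` sends `GetPDs` to all the processes it knows -/
  | poll (i : Proc)
  /-- the message `e`, sent in the event with index `m`, is received by its addressee -/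
  | receive (m : ℕ) (e : Envelope Proc)
  /-- the correct process `i` evaluates the waiting condition of the Core algorithm -/
  | core (i : Proc)
  /-- the Byzantine process `e.src` sends the message `e` -/
  | byzantine (e : Envelope Proc)

/-- The messages sent in an event, where `st` is the global state just before it. -/
def messagesSent (F : Finset Proc) (st : Proc → LocalState Proc) :
    Event Proc → Set (Envelope Proc)
  | Event.poll i => {e | e.src = i ∧ e.dst ∈ (st i).known ∧ e.msg = Msg.getPDs}
  | Event.receive _ e =>
      {e' | e.dst ∉ F ∧ e.msg = Msg.getPDs ∧
        e' = { src := e.dst, dst := e.src, msg := Msg.setPDs (st e.dst).pds }}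
  | Event.core _ => ∅
  | Event.byzantine e => {e}

/-- How an event changes the local state of a correct process `i` from `s` to `s'`. -/
def LocalStep (i : Proc) (s s' : LocalState Proc) : Event Proc → Prop
  | Event.poll _ => s' = s
  | Event.receive _ e => (e.dst = i → s' = handle s e.src e.msg) ∧ (e.dst ≠ i → s' = s)
  | Event.core j => (j = i → CoreStep s s') ∧ (j ≠ i → s' = s)
  | Event.byzantine _ => s' = s

/-- An execution: a sequence of events with their real times, and the global state before each
event. The local states of Byzantine processes carry no meaning. -/
structure Execution (Proc : Type*) where
  event : ℕ → Event Proc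
  time : ℕ → ℝ
  state : ℕ → Proc → LocalState Proc

/-- The messages sent in the event with index `n`. -/
def Execution.sent (X : Execution Proc) (F : Finset Proc) (n : ℕ) : Set (Envelope Proc) :=
  messagesSent F (X.state n) (X.event n)

/-- `X` is an execution, in the partially synchronous system with participant detectors `PD`, in
which all correct processes run the Core algorithm (and so the Discovery algorithm) and the
processes in `F` are Byzantine. -/
structure Execution.IsRun (X : Execution Proc) (PD : Proc → Finset Proc) (F : Finset Proc) :
    Prop where
  /-- time does not run backwards, and only finitely many events occur in bounded time -/
  time_mono : Monotone X.time
  time_unbounded : Filter.Tendsto X.time Filter.atTop Filter.atTop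
  init : ∀ i, i ∉ F → X.state 0 i = initState PD i
  step : ∀ n, ∀ i, i ∉ F → LocalStep i (X.state n i) (X.state (n + 1) i) (X.event n)
  /-- the actions of the algorithms are executed by correct processes -/
  poll_correct : ∀ n i, X.event n = Event.poll i → i ∉ F
  core_correct : ∀ n i, X.event n = Event.core i → i ∉ F
  /-- a Byzantine process sends arbitrary messages, but only in the name of a Byzantine process,
  and it cannot forge signatures: a correct process signs no record but its own true one -/
  byzantine_src : ∀ n e, X.event n = Event.byzantine e → e.src ∈ F
  byzantine_sign : ∀ n e pds, X.event n = Event.byzantine e → e.msg = Msg.setPDs pds →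
    ∀ k D, (k, D) ∈ pds → k ∉ F → D = PD k
  /-- the channels neither create nor duplicate messages -/
  receive_sent : ∀ n m e, X.event n = Event.receive m e → m < n ∧ e ∈ X.sent F m
  receive_once : ∀ n n' m e, X.event n = Event.receive m e → X.event n' = Event.receive m e →
    n = n'
  /-- messages between correct processes are never lost, and after some time `GST` their delays
  are bounded by some `δ` -/
  partial_synchrony : ∃ GST δ : ℝ, ∀ m, ∀ e ∈ X.sent F m, e.src ∉ F → e.dst ∉ F →
    ∃ n, X.event n = Event.receive m e ∧ X.time n ≤ max (X.time m) GST + δ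
  /-- the correct processes send their `GetPDs` requests again and again, also after the Core
  algorithm has terminated, and they keep evaluating the condition they wait for -/
  poll_often : ∀ i, i ∉ F → ∀ n, ∃ m, n ≤ m ∧ X.event m = Event.poll i
  core_often : ∀ i, i ∉ F → ∀ n, ∃ m, n ≤ m ∧ X.event m = Event.core i

end Model

end CUPFT

/-! The waiting condition is met by `y = f` and `R = W`, the sink component of the safe subgraph.
Every correct process reaches all of `W` through correct processes, and each of these answers
requests with its own record, so the records of `W` all arrive (`exists_record_of_reaches`). They
carry every edge inside `W`, which gives connectivity at least `f + 1`. Records of correct processes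
cannot be forged (`records_true`), so in the local graph an edge that leaves `W` can only end in
`F`. Hence every path from `W` to a correct process outside `W` has an interior vertex in `F`, and
at most `f` such paths are disjoint. A set `K` reached by more than `f` disjoint paths is therefore
contained in `F` (`coreGuard_sink`). Records are never discarded, so the condition persists until
its next evaluation. -/

namespace CUPFT

/-! ### Paths, connectivity and sink components. -/

section Graphs

variable {V : Type*}

lemma IsPath.mono {G H : Digraph V} {S T : Finset V} {i j : V} {p : List V}
    (hp : IsPath G S i j p) (hST : S ⊆ T) (hGH : ∀ a ∈ S, ∀ b ∈ S, G.Adj a b → H.Adj a b) :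
    IsPath H T i j p := by
  obtain ⟨h1, h2, h3, h4, h5⟩ := hp
  refine ⟨h1, h2, h3, ?_, fun v hv => hST (h5 v hv)⟩
  clear h1 h2 h3
  induction p with
  | nil => exact List.IsChain.nil
  | cons a l ih =>
    cases l with
    | nil => exact List.IsChain.singleton a
    | cons b l =>
      rw [List.isChain_cons_cons] at h4 ⊢
      exact ⟨hGH a (h5 a (by simp)) b (h5 b (by simp)) h4.1,
        ih h4.2 fun v hv => h5 v (List.mem_cons_of_mem _ hv)⟩

lemma IsPath.reaches {G : Digraph V} {S : Finset V} {i j : V} {p : List V}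
    (hp : IsPath G S i j p) : Reaches G S i j := by
  obtain ⟨h1, h2, -, h4, h5⟩ := hp
  induction p generalizing i with
  | nil => simp at h1
  | cons a l ih =>
    obtain rfl : a = i := by simpa using h1
    cases l with
    | nil =>
      obtain rfl : a = j := by simpa using h2
      exact Relation.ReflTransGen.refl
    | cons b l =>
      rw [List.isChain_cons_cons] at h4
      refine Relation.ReflTransGen.head (b := b) ⟨h5 a (by simp), h5 b (by simp), h4.1⟩ ?_
      exact ih (by simp) (by simpa using h2) h4.2 fun v hv => h5 v (List.mem_cons_of_mem _ hv)

/-- A path that leaves a set `W` visits the target of an edge that leaves `W`. -/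
lemma IsPath.exists_mem_of_leaves {G : Digraph V} {S : Finset V} {i j : V} {p : List V}
    (hp : IsPath G S i j p) {W : Set V} (hi : i ∈ W) (hj : j ∉ W) :
    ∃ a ∈ W, ∃ b ∉ W, G.Adj a b ∧ b ∈ p := by
  obtain ⟨h1, h2, -, h4, -⟩ := hp
  induction p generalizing i with
  | nil => simp at h1
  | cons a l ih =>
    obtain rfl : a = i := by simpa using h1
    cases l with
    | nil =>
      obtain rfl : a = j := by simpa using h2
      exact absurd hi hj
    | cons b l =>
      rw [List.isChain_cons_cons] at h4
      by_cases hb : b ∈ W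
      · obtain ⟨x, hx, y, hy, hxy, hyp⟩ := ih hb (by simp) (by simpa using h2) h4.2
        exact ⟨x, hx, y, hy, hxy, List.mem_cons_of_mem _ hyp⟩
      · exact ⟨a, hi, b, hb, h4.1, by simp⟩

lemma HasDisjointPaths.mono {G H : Digraph V} {S T : Finset V} {k : ℕ} {i j : V}
    (h : HasDisjointPaths G S k i j) (hST : S ⊆ T)
    (hGH : ∀ a ∈ S, ∀ b ∈ S, G.Adj a b → H.Adj a b) : HasDisjointPaths H T k i j := by
  obtain ⟨p, h1, h2, h3⟩ := h
  exact ⟨p, h1, fun a => (h2 a).mono hST hGH, h3⟩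

/-- The easy half of Menger's theorem: disjoint paths that all meet a set away from their
endpoints are at most as many as the elements of that set. -/
lemma HasDisjointPaths.le_card_of_meet {G : Digraph V} {S F : Finset V} {k : ℕ} {i j : V}
    (h : HasDisjointPaths G S k i j)
    (hF : ∀ p, IsPath G S i j p → ∃ v ∈ F, v ≠ i ∧ v ≠ j ∧ v ∈ p) : k ≤ F.card := by
  obtain ⟨p, -, h2, h3⟩ := h
  -- A blocking vertex chosen on each path is never an endpoint, so distinct paths get distinct
  -- vertices.
  choose v hvF hvi hvj hvp using fun a => hF (p a) (h2 a)
  have hinj : Set.InjOn v (Finset.univ : Finset (Fin k)) := by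
    intro a _ b _ hab
    by_contra hne
    rcases h3 a b hne (v a) (hvp a) (hab ▸ hvp b) with h | h
    · exact hvi a h
    · exact hvj a h
  simpa using Finset.card_le_card_of_injOn v (fun a _ => hvF a) hinj

lemma IsKStronglyConnected.le_strongConnectivity {G : Digraph V} {S : Finset V} {k : ℕ}
    (h : IsKStronglyConnected G S k) : k ≤ strongConnectivity G S :=
  -- The clause `k < S.card` bounds the set; `sSup` of an unbounded set of naturals would be `0`.
  le_csSup ⟨S.card, fun _ hm => hm.1.le⟩ h

lemma IsKStronglyConnected.mono {G H : Digraph V} {S : Finset V} {k : ℕ}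
    (h : IsKStronglyConnected G S k) (hGH : ∀ a ∈ S, ∀ b ∈ S, G.Adj a b → H.Adj a b) :
    IsKStronglyConnected H S k :=
  ⟨h.1, fun i hi j hj hij => (h.2 i hi j hj hij).mono subset_rfl hGH⟩

lemma IsSinkComponent.subset {G : Digraph V} {S W : Finset V} (h : IsSinkComponent G S W) :
    W ⊆ S := by
  obtain ⟨⟨v, -, hv⟩, -⟩ := h
  exact fun w hw => ((hv w).1 hw).1

lemma IsSinkComponent.mem_of_adj {G : Digraph V} {S W : Finset V} (h : IsSinkComponent G S W)
    {a b : V} (ha : a ∈ W) (hb : b ∈ S) (hab : G.Adj a b) : b ∈ W :=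
  h.2 a ha b hb (Relation.ReflTransGen.single ⟨h.subset ha, hb, hab⟩)

lemma IsOSRWithSink.reaches {G : Digraph V} {S W : Finset V} {k : ℕ}
    (h : IsOSRWithSink G S (k + 1) W) {i w : V} (hi : i ∈ S) (hw : w ∈ W) :
    Reaches G S i w := by
  by_cases hiW : i ∈ W
  · obtain ⟨⟨v, -, hv⟩, -⟩ := h.sink
    exact ((hv i).1 hiW).2.2.trans ((hv w).1 hw).2.1
  · obtain ⟨p, -, hp, -⟩ := h.paths_to_sink i hi hiW w hw
    exact (hp 0).reaches

end Graphs

/-! ### Effect of single steps on a local state. -/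

section Model

variable {Proc : Type*} [DecidableEq Proc]

lemma subset_handle (s : LocalState Proc) (j : Proc) (m : Msg Proc) :
    s.pds ⊆ (handle s j m).pds := by
  cases m with
  | getPDs => exact subset_rfl
  | setPDs pds =>
    simp only [handle]
    split_ifs
    exacts [Finset.subset_union_left, subset_rfl]

/-- The signers of all the records in `S_PD` are in `S_received`, and the processes that the
records list are in `S_known`. -/
def LocalState.Consistent (s : LocalState Proc) : Prop :=
  ∀ a D, (a, D) ∈ s.pds → a ∈ s.received ∧ D ⊆ s.known

lemma LocalState.Consistent.handle {s : LocalState Proc} (hs : s.Consistent) (j : Proc)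
    (m : Msg Proc) : (handle s j m).Consistent := by
  cases m with
  | getPDs => exact hs
  | setPDs pds =>
    simp only [CUPFT.handle]
    split_ifs
    · intro a D h
      rcases Finset.mem_union.1 h with h | h
      · exact ⟨Finset.mem_union_left _ (hs a D h).1,
          (hs a D h).2.trans Finset.subset_union_left⟩
      · exact ⟨Finset.mem_union_right _ (Finset.mem_image_of_mem Prod.fst h),
          (Finset.subset_biUnion_of_mem Prod.snd h).trans Finset.subset_union_right⟩
    · exact hs

lemma CoreStep.sets_eq {s s' : LocalState Proc} (h : CoreStep s s') :
    s'.pds = s.pds ∧ s'.known = s.known ∧ s'.received = s.received := by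
  rcases h with ⟨-, _, _, _, -, rfl, -⟩ | ⟨-, rfl⟩ <;> exact ⟨rfl, rfl, rfl⟩

/-- What a step does to the discovery part of the local state: nothing, or a message is
handled. -/
lemma LocalStep.cases {i : Proc} {s s' : LocalState Proc} {ev : Event Proc}
    (h : LocalStep i s s' ev) :
    (s'.pds = s.pds ∧ s'.known = s.known ∧ s'.received = s.received) ∨
      ∃ m e, ev = Event.receive m e ∧ e.dst = i ∧ s' = handle s e.src e.msg := by
  cases ev with
  | poll j => obtain rfl : s' = s := h; exact Or.inl ⟨rfl, rfl, rfl⟩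
  | byzantine e => obtain rfl : s' = s := h; exact Or.inl ⟨rfl, rfl, rfl⟩
  | core j =>
    by_cases hj : j = i
    · exact Or.inl (h.1 hj).sets_eq
    · obtain rfl := h.2 hj; exact Or.inl ⟨rfl, rfl, rfl⟩
  | receive m e =>
    by_cases hj : e.dst = i
    · exact Or.inr ⟨m, e, rfl, hj, h.1 hj⟩
    · obtain rfl := h.2 hj; exact Or.inl ⟨rfl, rfl, rfl⟩

/-! ### Invariants of executions, spread of records, termination. -/

namespace Execution.IsRun

variable {X : Execution Proc} {PD : Proc → Finset Proc} {F : Finset Proc}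

lemma pds_mono (hX : X.IsRun PD F) {i : Proc} (hi : i ∉ F) :
    Monotone fun n => (X.state n i).pds := by
  refine monotone_nat_of_le_succ fun n => ?_
  rcases (hX.step n i hi).cases with h | ⟨m, e, -, -, h⟩
  · exact h.1.ge
  · simpa only [h] using subset_handle _ _ _

lemma known_mono (hX : X.IsRun PD F) {i : Proc} (hi : i ∉ F) :
    Monotone fun n => (X.state n i).known := by
  refine monotone_nat_of_le_succ fun n => ?_
  rcases (hX.step n i hi).cases with h | ⟨m, e, -, -, h⟩
  · exact h.2.1.ge
  · simp only [h]
    cases e.msg with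
    | getPDs => exact le_rfl
    | setPDs pds =>
      simp only [handle]
      split_ifs
      exacts [Finset.subset_union_left, le_rfl]

lemma own_record (hX : X.IsRun PD F) {i : Proc} (hi : i ∉ F) (n : ℕ) :
    (i, PD i) ∈ (X.state n i).pds :=
  hX.pds_mono hi (Nat.zero_le n) (by simp [hX.init i hi, initState])

lemma consistent (hX : X.IsRun PD F) {i : Proc} (hi : i ∉ F) (n : ℕ) :
    (X.state n i).Consistent := by
  induction n with
  | zero =>
    rw [hX.init i hi]
    intro a D h
    obtain ⟨rfl, rfl⟩ : a = i ∧ D = PD i := by simpa [initState] using h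
    exact ⟨by simp [initState], Finset.subset_insert _ _⟩
  | succ n ih =>
    rcases (hX.step n i hi).cases with ⟨h1, h2, h3⟩ | ⟨m, e, -, -, h⟩
    · simpa only [LocalState.Consistent, h1, h2, h3] using ih
    · rw [h]; exact ih.handle _ _

/-- Signatures of correct processes are not forged. -/
lemma records_true (hX : X.IsRun PD F) (n : ℕ) :
    ∀ i, i ∉ F → ∀ k D, (k, D) ∈ (X.state n i).pds → k ∉ F → D = PD k := by
  -- Strong induction, for all correct processes at once: a received record may come from the state
  -- of another process at a much earlier event.
  induction n using Nat.strong_induction_on with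
  | _ n ih =>
    intro i hi k D hkD hk
    cases n with
    | zero =>
      rw [hX.init i hi] at hkD
      obtain ⟨rfl, rfl⟩ : k = i ∧ D = PD i := by simpa [initState] using hkD
      rfl
    | succ n =>
      rcases (hX.step n i hi).cases with ⟨h1, -, -⟩ | ⟨m, e, hev, hdst, h⟩
      · exact ih n n.lt_succ_self i hi k D (h1 ▸ hkD) hk
      · obtain ⟨hmn, hsent⟩ := hX.receive_sent n m e hev
        have hold := fun h' => ih n n.lt_succ_self i hi k D h' hk
        rw [h] at hkD
        cases hmsg : e.msg with
        | getPDs => rw [hmsg] at hkD; exact hold hkD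
        | setPDs pds =>
          rw [hmsg] at hkD
          simp only [handle] at hkD
          split_ifs at hkD
          · rcases Finset.mem_union.1 hkD with h' | h'
            · exact hold h'
            -- Only two events send records: a Byzantine sending, restricted by `byzantine_sign`,
            -- and a reply, which copies the state of a correct process at the earlier index `m`.
            · unfold Execution.sent at hsent
              cases hevm : X.event m with
              | poll j =>
                rw [hevm] at hsent
                exact absurd (hmsg.symm.trans hsent.2.2) (by simp)
              | core j => rw [hevm] at hsent; exact hsent.elim
              | byzantine e' =>
                rw [hevm] at hsent
                obtain rfl : e = e' := hsent
                exact hX.byzantine_sign m e pds hevm hmsg k D h' hk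
              | receive m' e' =>
                rw [hevm] at hsent
                obtain ⟨hdst', -, rfl⟩ := hsent
                obtain rfl : (X.state m e'.dst).pds = pds := by simpa using hmsg
                exact ih m (hmn.trans n.lt_succ_self) e'.dst hdst' k D h' hk
          · exact hold hkD

/-- A correct process eventually has the record of each correct process that it knows. -/
lemma exists_record_of_known (hX : X.IsRun PD F) {i j : Proc} (hi : i ∉ F) (hj : j ∉ F) {n : ℕ}
    (hij : j ∈ (X.state n i).known) :
    ∃ m, (j, PD j) ∈ (X.state m i).pds := by
  obtain ⟨GST, δ, hsync⟩ := hX.partial_synchrony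
  obtain ⟨m, hnm, hm⟩ := hX.poll_often i hi n
  -- A round trip: the request arrives at `n₁`, that same event sends the reply, and the reply
  -- arrives at `n₂`. Eventual delivery suffices; the time bounds are dropped.
  obtain ⟨n₁, hn₁, -⟩ := hsync m ⟨i, j, Msg.getPDs⟩
    (by simpa [Execution.sent, hm, messagesSent] using hX.known_mono hi hnm hij) hi hj
  obtain ⟨n₂, hn₂, -⟩ := hsync n₁ ⟨j, i, Msg.setPDs (X.state n₁ j).pds⟩
    (by simpa [Execution.sent, hn₁, messagesSent] using hj) hj hi
  have hown := hX.own_record hj n₁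
  have hstep := hX.step n₂ i hi
  rw [hn₂] at hstep
  refine ⟨n₂ + 1, ?_⟩
  rw [hstep.1 rfl]
  -- The sender's own record is in its reply, so the acceptance test of `handle` succeeds.
  have hmem : j ∈ (X.state n₁ j).pds.image Prod.fst := Finset.mem_image_of_mem Prod.fst hown
  simp only [handle, if_pos hmem]
  exact Finset.mem_union_right _ hown

/-- A correct process eventually has the record of each process that it reaches in the safe
subgraph. -/
lemma exists_record_of_reaches [Fintype Proc] (hX : X.IsRun PD F) {i j : Proc} (hi : i ∉ F)
    (hij : Reaches (knowledgeGraph PD) Fᶜ i j) : ∃ n, (j, PD j) ∈ (X.state n i).pds := by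
  induction hij with
  | refl => exact ⟨0, hX.own_record hi 0⟩
  | tail _ hbc ih =>
    obtain ⟨n, hn⟩ := ih
    exact hX.exists_record_of_known hi (Finset.mem_compl.1 hbc.2.1)
      ((hX.consistent hi n _ _ hn).2 hbc.2.2)

/-- A process that has the records of all members of the sink component finds that the waiting
condition holds, with the fault threshold for `y` and the sink component for `R`. -/
lemma coreGuard_sink [Fintype Proc] (hX : X.IsRun PD F) {f : ℕ} (hF : F.card ≤ f) {W : Finset Proc}
    (hW : IsOSRWithSink (knowledgeGraph PD) Fᶜ (f + 1) W) {i : Proc} (hi : i ∉ F) {n : ℕ}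
    (hrec : ∀ w ∈ W, (w, PD w) ∈ (X.state n i).pds) : (X.state n i).CoreGuard f W := by
  have hcorrect : ∀ w ∈ W, w ∉ F := fun w hw => Finset.mem_compl.1 (hW.sink.subset hw)
  refine ⟨fun w hw => (hX.consistent hi n w _ (hrec w hw)).1, ?_, ?_⟩
  · have hmono : ∀ a ∈ W, ∀ b ∈ W, (knowledgeGraph PD).Adj a b → (X.state n i).graph.Adj a b :=
      fun a ha b _ hab => ⟨PD a, hrec a ha, hab⟩
    exact (hW.sink_connectivity.mono hmono).le_strongConnectivity
  · rintro K hK ⟨⟨w, hw⟩, -, hpaths⟩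
    -- It suffices that `K ⊆ F`.
    refine (Finset.card_le_card fun t ht => ?_).trans hF
    by_contra htF
    have htW : t ∉ W := (Finset.mem_sdiff.1 (hK ht)).2
    -- If `t` were correct, `F` would block `f + 1` disjoint paths, although it has at most `f`
    -- elements.
    refine absurd ((hpaths w hw t ht).le_card_of_meet (F := F) fun p hp => ?_) (by omega)
    obtain ⟨a, ha, b, hb, ⟨D, hD, hbD⟩, hbp⟩ := hp.exists_mem_of_leaves (W := W) hw htW
    obtain rfl := hX.records_true n i hi a D hD (hcorrect a ha)
    have hbF : b ∈ F := by
      by_contra hbF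
      exact hb (hW.sink.mem_of_adj ha (Finset.mem_compl.2 hbF) hbD)
    -- `b` is interior to the path: `w` lies in `W` and `t` is correct, while `b` is neither.
    exact ⟨b, hbF, fun h => hb (h ▸ hw), fun h => htF (h ▸ hbF), hbp⟩

/-- If the waiting condition holds from some point on, then the Core algorithm terminates. -/
lemma exists_result (hX : X.IsRun PD F) {i : Proc} (hi : i ∉ F) {n : ℕ}
    (h : ∀ m, n ≤ m → ∃ y R, (X.state m i).CoreGuard y R) :
    ∃ m, (X.state m i).result ≠ none := by
  obtain ⟨m, hnm, hm⟩ := hX.core_often i hi n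
  have hstep := hX.step m i hi
  rw [hm] at hstep
  rcases hstep.1 rfl with ⟨-, y, R, res, -, h', -⟩ | ⟨h' | h', -⟩
  · exact ⟨m + 1, by simp [h']⟩
  · exact ⟨m, h'⟩
  · exact absurd (h m hnm) h'

end Execution.IsRun

end Model

end CUPFT

theorem mainTheorem7 {Proc : Type*} [Fintype Proc] [DecidableEq Proc]
    (PD : Proc → Finset Proc) (F : Finset Proc) (f : ℕ) (hF : F.card ≤ f)
    (hG : CUPFT.SatisfiesBFTCUPFT PD F f)
    (X : CUPFT.Execution Proc) (hX : X.IsRun PD F) (i : Proc) (hi : i ∉ F) :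
    (∃ n, (X.state n i).result ≠ none) ∧
      ∃ n y R, (X.state n i).CoreGuard y R := by
  obtain ⟨W, P, hWP, -, -⟩ := hG
  -- For fixed `y` and `R` the guard is not monotone in general, since new records add paths; what
  -- persists is possession of the sink's records.
  have hev : ∀ᶠ n in Filter.atTop, ∀ w ∈ W, (w, PD w) ∈ (X.state n i).pds := by
    refine (Filter.eventually_all_finset W).2 fun w hw => ?_
    obtain ⟨n, hn⟩ := hX.exists_record_of_reaches hi
      (hWP.osr.reaches (Finset.mem_compl.2 hi) hw)
    exact Filter.eventually_atTop.2 ⟨n, fun m hm => hX.pds_mono hi hm hn⟩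
  obtain ⟨n, hn⟩ := Filter.eventually_atTop.1 hev
  have hguard := fun m hm => hX.coreGuard_sink hF hWP.osr hi (hn m hm)
  exact ⟨hX.exists_result hi fun m hm => ⟨f, W, hguard m hm⟩, n, f, W, hguard n le_rfl⟩
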